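/- Let $N\ge 1$, $1<p<\infty$, let $\Omega\subset\mathbb{R}^N$ be a bounded open set, let $0<\alpha<\beta$ and $0<\kappa<|\Omega|$, put $c:=(\beta/\alpha)^{1/(p-1)}-1>0$, and let $f\in W^{-1,p'}(\Omega)=W^{1,p}_0(\Omega)^*$, with duality product $\langle f,u\rangle$. Consider the relaxed problem $$\min\Big\{\frac1p\int_\Omega\frac{|\nabla u|^p}{(1+c\,\theta)^{p-1}}\,dx-\langle f,u\rangle \;:\; u\in W^{1,p}_0(\Omega),\ \theta\in L^\infty(\Omega;[0,1]),\ \int_\Omega\theta\,dx\le\kappa\Big\}.\tag{P}$$ For $\mu\ge 0$ let $F_\mu:[0,\infty)\to\mathbb{R}$ be the function defined by $F_\mu(0)=0$ and $$F_\mu'(s)=\begin{cases}s^{p-1}&\text{if }0\le s<\mu,\\ \mu^{p-1}&\text{if }\mu\le s\le(1+c)\mu,\\ \dfrac{s^{p-1}}{(1+c)^{p-1}}&\text{if }s>(1+c)\mu.\end{cases}$$ Then, for every $\mu\ge0$, $F_\mu$ is convex and belongs to $C^1([0,\infty))\cap W^{2,\infty}_{\rm loc}(0,\infty)$. Moreover,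 a pair $(\hat u,\hat\theta)\in W^{1,p}_0(\Omega)\times L^\infty(\Omega;[0,1])$ is a solution of (P) if and only if there exists $\hat\mu\ge0$ such that $\hat u$ is a solution of $$\min_{u\in W^{1,p}_0(\Omega)}\Big(\int_\Omega F_{\hat\mu}(|\nabla u|)\,dx-\langle f,u\rangle\Big)$$ and $\hat\mu$, $\hat\theta$ are related as follows. \begin{itemize} \item If $\hat\mu=0$, then $\hat\theta=1$ a.e. in $\{|\nabla\hat u|>0\}$ and $\int_\Omega\hat\theta\,dx\le\kappa$. \item If $\hat\mu>0$, then $\int_\Omega\hat\theta\,dx=\kappa$ and, a.e. in $\Omega$, $$\hat\theta=\begin{cases}0&\text{if }0\le|\nabla\hat u|<\hat\mu,\\ \dfrac1c\Big(\dfrac{|\nabla\hat u|}{\hat\mu}-1\Big)&\text{if }\hat\mu\le|\nabla\hat u|\le(1+c)\hat\mu,\\ 1&\text{if }|\nabla\hat u|>(1+c)\hat\mu.\end{cases}$$ \end{itemize} -/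

import Mathlib

open MeasureTheory Set TopologicalSpace
open scoped ENNReal ContDiff Distributions Gradient

noncomputable section

namespace TwoPhase

/-! ### The Sobolev spaces `W^{1,p}(Ω)`, `W_0^{1,p}(Ω)` and the dual `W^{-1,p'}(Ω)` -/

instance factOneLeOfReal (p : ℝ) [h : Fact (1 < p)] : Fact (1 ≤ ENNReal.ofReal p) :=
  ⟨ENNReal.one_le_ofReal.2 h.out.le⟩

/-- The space `ℝ^N` with its Euclidean norm. -/
abbrev Space (N : ℕ) : Type := EuclideanSpace ℝ (Fin N)

/-- Lebesgue measure on the open set `Ω`. -/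
abbrev lebesgueOn {N : ℕ} (Ω : Opens (Space N)) : Measure (Space N) :=
  volume.restrict (Ω : Set (Space N))

/-- `g` is the weak (distributional) gradient of `u` in `Ω`. -/
def IsWeakGradient {N : ℕ} (Ω : Opens (Space N)) (u : Space N → ℝ) (g : Space N → Space N) :
    Prop :=
  ∀ φ : 𝓓(Ω, ℝ), ∫ x in (Ω : Set (Space N)), u x • ∇ (φ : Space N → ℝ) x =
    - ∫ x in (Ω : Set (Space N)), φ x • g x

/-- The gradient of a test function is continuous with compact support. -/
theorem gradient_continuous {N : ℕ} {Ω : Opens (Space N)} (φ : 𝓓(Ω, ℝ)) :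
    Continuous (∇ (φ : Space N → ℝ)) :=
  (InnerProductSpace.toDual ℝ (Space N)).symm.continuous.comp
    (φ.contDiff.continuous_fderiv (by simp))

theorem gradient_hasCompactSupport {N : ℕ} {Ω : Opens (Space N)} (φ : 𝓓(Ω, ℝ)) :
    HasCompactSupport (∇ (φ : Space N → ℝ)) :=
  (φ.hasCompactSupport.fderiv (𝕜 := ℝ)).comp_left
    (g := (InnerProductSpace.toDual ℝ (Space N)).symm) (map_zero _)

theorem gradient_add {N : ℕ} {Ω : Opens (Space N)} (φ ψ : 𝓓(Ω, ℝ)) (x : Space N) :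
    ∇ ((φ + ψ : 𝓓(Ω, ℝ)) : Space N → ℝ) x
      = ∇ (φ : Space N → ℝ) x + ∇ (ψ : Space N → ℝ) x := by
  have h1 : DifferentiableAt ℝ (φ : Space N → ℝ) x :=
    (φ.contDiff.differentiable (by simp)).differentiableAt
  have h2 : DifferentiableAt ℝ (ψ : Space N → ℝ) x :=
    (ψ.contDiff.differentiable (by simp)).differentiableAt
  have : ((φ + ψ : 𝓓(Ω, ℝ)) : Space N → ℝ) = (φ : Space N → ℝ) + ψ := rfl
  rw [this, gradient, gradient, gradient, fderiv_add h1 h2, map_add]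

theorem gradient_smul {N : ℕ} {Ω : Opens (Space N)} (a : ℝ) (φ : 𝓓(Ω, ℝ)) (x : Space N) :
    ∇ ((a • φ : 𝓓(Ω, ℝ)) : Space N → ℝ) x = a • ∇ (φ : Space N → ℝ) x := by
  have h1 : DifferentiableAt ℝ (φ : Space N → ℝ) x :=
    (φ.contDiff.differentiable (by simp)).differentiableAt
  have : ((a • φ : 𝓓(Ω, ℝ)) : Space N → ℝ) = a • (φ : Space N → ℝ) := rfl
  rw [this, gradient, gradient, fderiv_const_smul h1]
  simp

theorem integrable_smul_gradient {N : ℕ} {Ω : Opens (Space N)} {p : ℝ} [Fact (1 < p)]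
    (u : Lp ℝ (ENNReal.ofReal p) (lebesgueOn Ω)) (φ : 𝓓(Ω, ℝ)) :
    Integrable (fun x => u x • ∇ (φ : Space N → ℝ) x) (lebesgueOn Ω) := by
  have h : LocallyIntegrable (u : Space N → ℝ) (lebesgueOn Ω) :=
    (Lp.memLp u).locallyIntegrable Fact.out
  exact h.integrable_smul_right_of_hasCompactSupport (gradient_continuous φ)
    (gradient_hasCompactSupport φ)

theorem integrable_smul_field {N : ℕ} {Ω : Opens (Space N)} {p : ℝ} [Fact (1 < p)]
    (g : Lp (Space N) (ENNReal.ofReal p) (lebesgueOn Ω)) (φ : 𝓓(Ω, ℝ)) :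
    Integrable (fun x => φ x • g x) (lebesgueOn Ω) := by
  have h : LocallyIntegrable (g : Space N → Space N) (lebesgueOn Ω) :=
    (Lp.memLp g).locallyIntegrable Fact.out
  exact h.integrable_smul_left_of_hasCompactSupport φ.continuous φ.hasCompactSupport

/-- The Sobolev space `W^{1,p}(Ω)`: the functions `u ∈ L^p(Ω)` that have a weak gradient
`g ∈ L^p(Ω)^N`. An element is recorded together with its weak gradient, as the pair `(u, g)`; the
norm inherited from the product is equivalent to the usual one. -/
def W1 {N : ℕ} (p : ℝ) [Fact (1 < p)] (Ω : Opens (Space N)) :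
    Submodule ℝ (Lp ℝ (ENNReal.ofReal p) (lebesgueOn Ω) ×
      Lp (Space N) (ENNReal.ofReal p) (lebesgueOn Ω)) where
  carrier := {w | IsWeakGradient Ω w.1 w.2}
  zero_mem' := by
    intro φ
    have h1 : ∀ᵐ x ∂(lebesgueOn Ω),
        (0 : Lp ℝ (ENNReal.ofReal p) (lebesgueOn Ω)) x • ∇ (φ : Space N → ℝ) x = 0 := by
      filter_upwards [Lp.coeFn_zero ℝ (ENNReal.ofReal p) (lebesgueOn Ω)] with x hx
      rw [hx, Pi.zero_apply, zero_smul]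
    have h2 : ∀ᵐ x ∂(lebesgueOn Ω),
        φ x • (0 : Lp (Space N) (ENNReal.ofReal p) (lebesgueOn Ω)) x = 0 := by
      filter_upwards [Lp.coeFn_zero (Space N) (ENNReal.ofReal p) (lebesgueOn Ω)] with x hx
      rw [hx, Pi.zero_apply, smul_zero]
    rw [Prod.fst_zero, Prod.snd_zero, integral_congr_ae h1, integral_congr_ae h2]
    simp
  add_mem' := by
    intro v w hv hw φ
    have h1 : ∀ᵐ x ∂(lebesgueOn Ω), (v.1 + w.1) x • ∇ (φ : Space N → ℝ) x =
        v.1 x • ∇ (φ : Space N → ℝ) x + w.1 x • ∇ (φ : Space N → ℝ) x := by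
      filter_upwards [Lp.coeFn_add v.1 w.1] with x hx
      rw [hx, Pi.add_apply, add_smul]
    have h2 : ∀ᵐ x ∂(lebesgueOn Ω), φ x • (v.2 + w.2) x = φ x • v.2 x + φ x • w.2 x := by
      filter_upwards [Lp.coeFn_add v.2 w.2] with x hx
      rw [hx, Pi.add_apply, smul_add]
    rw [Prod.fst_add, Prod.snd_add, integral_congr_ae h1, integral_congr_ae h2,
      integral_add (integrable_smul_gradient v.1 φ) (integrable_smul_gradient w.1 φ),
      integral_add (integrable_smul_field v.2 φ) (integrable_smul_field w.2 φ),
      hv φ, hw φ, neg_add]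
  smul_mem' := by
    intro a w hw φ
    have h1 : ∀ᵐ x ∂(lebesgueOn Ω), (a • w.1) x • ∇ (φ : Space N → ℝ) x =
        a • (w.1 x • ∇ (φ : Space N → ℝ) x) := by
      filter_upwards [Lp.coeFn_smul a w.1] with x hx
      rw [hx, Pi.smul_apply, smul_assoc]
    have h2 : ∀ᵐ x ∂(lebesgueOn Ω), φ x • (a • w.2) x = a • (φ x • w.2 x) := by
      filter_upwards [Lp.coeFn_smul a w.2] with x hx
      rw [hx, Pi.smul_apply, smul_comm]
    rw [Prod.smul_fst, Prod.smul_snd, integral_congr_ae h1, integral_congr_ae h2,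
      integral_smul, integral_smul, hw φ, smul_neg]

/-- The elements of `W^{1,p}(Ω)` given by the functions of `C_c^∞(Ω)`. -/
def testSubspace {N : ℕ} (p : ℝ) [Fact (1 < p)] (Ω : Opens (Space N)) :
    Submodule ℝ (W1 p Ω) where
  carrier := {w | ∃ φ : 𝓓(Ω, ℝ), w.1.1 =ᵐ[lebesgueOn Ω] (φ : Space N → ℝ) ∧
    w.1.2 =ᵐ[lebesgueOn Ω] ∇ (φ : Space N → ℝ)}
  zero_mem' := by
    refine ⟨0, Lp.coeFn_zero _ _ _, ?_⟩
    have h : ∇ ((0 : 𝓓(Ω, ℝ)) : Space N → ℝ) = 0 := by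
      funext x
      have : ((0 : 𝓓(Ω, ℝ)) : Space N → ℝ) = fun _ => 0 := rfl
      rw [this, gradient]
      simp
    rw [h]
    exact Lp.coeFn_zero _ _ _
  add_mem' := by
    rintro v w ⟨φ, h1, h2⟩ ⟨ψ, h3, h4⟩
    refine ⟨φ + ψ, ?_, ?_⟩
    · exact (Lp.coeFn_add v.1.1 w.1.1).trans (h1.add h3)
    · refine (Lp.coeFn_add v.1.2 w.1.2).trans ((h2.add h4).trans ?_)
      exact Filter.Eventually.of_forall fun x => (gradient_add φ ψ x).symm
  smul_mem' := by
    rintro a w ⟨φ, h1, h2⟩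
    refine ⟨a • φ, ?_, ?_⟩
    · exact (Lp.coeFn_smul a w.1.1).trans (h1.const_smul a)
    · refine (Lp.coeFn_smul a w.1.2).trans ((h2.const_smul a).trans ?_)
      exact Filter.Eventually.of_forall fun x => (gradient_smul a φ x).symm

/-- The Sobolev space `W_0^{1,p}(Ω)`: the closure of `C_c^∞(Ω)` in `W^{1,p}(Ω)`. -/
def W10 {N : ℕ} (p : ℝ) [Fact (1 < p)] (Ω : Opens (Space N)) : Submodule ℝ (W1 p Ω) :=
  (testSubspace p Ω).topologicalClosure

/-- The gradient of an element of `W_0^{1,p}(Ω)`. -/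
def grad {N : ℕ} {p : ℝ} [Fact (1 < p)] {Ω : Opens (Space N)} (u : W10 p Ω) :
    Lp (Space N) (ENNReal.ofReal p) (lebesgueOn Ω) :=
  u.1.1.2

/-- `W^{-1,p'}(Ω)`: the topological dual of `W_0^{1,p}(Ω)`; the duality product `⟨f, u⟩` is
`f u`. -/
abbrev WDual {N : ℕ} (p : ℝ) [Fact (1 < p)] (Ω : Opens (Space N)) : Type :=
  StrongDual ℝ (W10 p Ω)

/-! ### The relaxed problem -/

/-- `L^∞(Ω;[0,1])`. -/
def proportions {N : ℕ} (Ω : Opens (Space N)) : Set (Lp ℝ ∞ (lebesgueOn Ω)) :=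
  {θ | ∀ᵐ x ∂(lebesgueOn Ω), θ x ∈ Icc (0 : ℝ) 1}

/-- The constant `c = (β/α)^{1/(p-1)} - 1`. -/
def contrast (p α β : ℝ) : ℝ := (β / α) ^ (1 / (p - 1)) - 1

/-- The functional `(1/p) ∫_Ω |∇u|^p / (1 + c θ)^{p-1} dx - ⟨f, u⟩`. -/
def relaxedEnergy {N : ℕ} {p : ℝ} [Fact (1 < p)] {Ω : Opens (Space N)} (c : ℝ) (f : WDual p Ω)
    (u : W10 p Ω) (θ : Lp ℝ ∞ (lebesgueOn Ω)) : ℝ :=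
  1 / p * (∫ x in (Ω : Set (Space N)), ‖grad u x‖ ^ p / (1 + c * θ x) ^ (p - 1)) - f u

/-- The pairs `(u, θ)` admissible for the relaxed problem: `u ∈ W_0^{1,p}(Ω)`,
`θ ∈ L^∞(Ω;[0,1])` and `∫_Ω θ dx ≤ κ`. -/
def admissible {N : ℕ} (p : ℝ) [Fact (1 < p)] (Ω : Opens (Space N)) (κ : ℝ) :
    Set (W10 p Ω × Lp ℝ ∞ (lebesgueOn Ω)) :=
  {w | w.2 ∈ proportions Ω ∧ ∫ x in (Ω : Set (Space N)), w.2 x ≤ κ}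

/-- `(u, θ)` is a solution of the relaxed minimization problem. -/
def IsRelaxedSolution {N : ℕ} {p : ℝ} [Fact (1 < p)] {Ω : Opens (Space N)} (c κ : ℝ)
    (f : WDual p Ω) (u : W10 p Ω) (θ : Lp ℝ ∞ (lebesgueOn Ω)) : Prop :=
  (u, θ) ∈ admissible p Ω κ ∧
    ∀ w ∈ admissible p Ω κ, relaxedEnergy c f u θ ≤ relaxedEnergy c f w.1 w.2

/-! ### The function `F` and the problem without the proportion -/

/-- The derivative `F'` of the integrand, on `[0,∞)`. -/
def dF (p c μ : ℝ) (s : ℝ) : ℝ :=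
  if s < μ then s ^ (p - 1)
  else if s ≤ (1 + c) * μ then μ ^ (p - 1)
  else s ^ (p - 1) / (1 + c) ^ (p - 1)

/-- The integrand `F`: the primitive of `F'` with `F(0) = 0`. -/
def F (p c μ : ℝ) (s : ℝ) : ℝ := ∫ t in (0 : ℝ)..s, dF p c μ t

/-- `u` is a solution of `min_{u ∈ W_0^{1,p}(Ω)} (∫_Ω F(|∇u|) dx - ⟨f, u⟩)`. -/
def IsFMinimizer {N : ℕ} {p : ℝ} [Fact (1 < p)] {Ω : Opens (Space N)} (c μ : ℝ)
    (f : WDual p Ω) (u : W10 p Ω) : Prop :=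
  ∀ v : W10 p Ω,
    (∫ x in (Ω : Set (Space N)), F p c μ ‖grad u x‖) - f u ≤
      (∫ x in (Ω : Set (Space N)), F p c μ ‖grad v x‖) - f v

/-- `g ∈ L^∞_loc(U)`. -/
def MemLInftyLoc (U : Opens ℝ) (g : ℝ → ℝ) : Prop :=
  ∀ K : Set ℝ, IsCompact K → K ⊆ U → MemLp g ∞ (volume.restrict K)

/-- `g'` is the weak derivative of `g` in the open set `U` of the line. -/
def IsWeakDeriv (U : Opens ℝ) (g g' : ℝ → ℝ) : Prop :=
  ∀ φ : 𝓓(U, ℝ), ∫ t in (U : Set ℝ), g t * deriv (φ : ℝ → ℝ) t =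
    - ∫ t in (U : Set ℝ), g' t * φ t

/-- `g ∈ W^{2,∞}_loc(U)`. -/
def MemW2InftyLoc (U : Opens ℝ) (g : ℝ → ℝ) : Prop :=
  ∃ g₁ g₂ : ℝ → ℝ, MemLInftyLoc U g ∧ MemLInftyLoc U g₁ ∧ MemLInftyLoc U g₂ ∧
    IsWeakDeriv U g g₁ ∧ IsWeakDeriv U g₁ g₂

/-- The open half-line `(0,∞)`. -/
def posHalfLine : Opens ℝ := ⟨Ioi 0, isOpen_Ioi⟩

/-- The relations between `θ` and `∇u` for a given `μ ≥ 0`. -/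
def ProportionRelation {N : ℕ} {p : ℝ} [Fact (1 < p)] {Ω : Opens (Space N)} (c κ μ : ℝ)
    (u : W10 p Ω) (θ : Lp ℝ ∞ (lebesgueOn Ω)) : Prop :=
  (μ = 0 →
    (∀ᵐ x ∂(lebesgueOn Ω), 0 < ‖grad u x‖ → θ x = 1) ∧
    ∫ x in (Ω : Set (Space N)), θ x ≤ κ) ∧
  (0 < μ →
    (∀ᵐ x ∂(lebesgueOn Ω), θ x =
      if ‖grad u x‖ < μ then 0
      else if ‖grad u x‖ ≤ (1 + c) * μ then 1 / c * (‖grad u x‖ / μ - 1)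
      else 1) ∧
    ∫ x in (Ω : Set (Space N)), θ x = κ)

end TwoPhase

end

namespace TwoPhase

/-! The problem is convex and has one affine constraint, so it is equivalent to minimizing a
Lagrangian. The function `(t, s) ↦ t ^ p / s ^ (p - 1)` is jointly convex, and `θ = 0` is a Slater
point because `κ > 0`; hence a solution has a multiplier `l ≥ 0` with complementary slackness
(`ConvexOn.exists_lagrange_multiplier`). Write `l = c (p - 1) / p * μ ^ p`.

The link with `F` is pointwise: for fixed `t = |∇u|`, the minimum over `θ ∈ [0,1]` of `t ^ p / (p (1
+ c θ) ^ (p - 1)) + l θ` is `F t`, and the minimizers are exactly the stated proportions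
(`F_le_and_eq_iff`). This rests on the tangent planes of the perspective function
(`tangent_le_perspective`). After integration, minimizing the Lagrangian in `θ` leaves the
`F`-energy of `u`, and the equality case gives the formula for `θ`. The converse is weak duality.

The regularity of `F` follows from its derivative, which is continuous, nondecreasing, and smooth on
`(0,∞)` off two thresholds. -/

theorem contrast_pos {p α β : ℝ} (hp : 1 < p) (hα : 0 < α) (hαβ : α < β) :
    0 < contrast p α β := by
  have h1 : 1 < β / α := (one_lt_div hα).2 hαβ
  have h2 : 0 < 1 / (p - 1) := by
    have : 0 < p - 1 := by linarith
    positivity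
  have := Real.one_lt_rpow h1 h2
  unfold contrast
  linarith

/-! ### Young's inequality for the perspective function of `t ↦ t ^ p` -/

theorem rpow_eq_rpow_sub_one_mul {p s : ℝ} (hp : 1 < p) (hs : 0 ≤ s) :
    s ^ p = s ^ (p - 1) * s := by
  rcases hs.eq_or_lt with rfl | hs
  · rw [Real.zero_rpow (by linarith), mul_zero]
  · rw [Real.rpow_sub_one hs.ne', div_mul_cancel₀ _ hs.ne']

theorem perspective_mul_mul {p r m s : ℝ} (hp : 1 < p) (hr : 0 ≤ r) (hm : 0 ≤ m) (hs : 0 < s) :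
    (r * (m * s)) ^ p / s ^ (p - 1) = r ^ p * (m ^ p * s) := by
  have h : 0 < s ^ (p - 1) := Real.rpow_pos_of_pos hs _
  rw [Real.mul_rpow hr (by positivity), Real.mul_rpow hm hs.le,
    rpow_eq_rpow_sub_one_mul hp hs.le]
  field_simp

/-- The left side is the tangent plane along the ray `t = m s`. By homogeneity, putting `t = r (m
s)` reduces the claim to Bernoulli's inequality `1 + p (r - 1) ≤ r ^ p`. -/
theorem tangent_le_perspective {p t s m : ℝ} (hp : 1 < p) (ht : 0 ≤ t) (hs : 0 < s)
    (hm : 0 ≤ m) : p * m ^ (p - 1) * t - (p - 1) * m ^ p * s ≤ t ^ p / s ^ (p - 1) := by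
  rcases hm.eq_or_lt with rfl | hm
  · rw [Real.zero_rpow (by linarith), Real.zero_rpow (by linarith)]
    have : 0 ≤ t ^ p / s ^ (p - 1) := by positivity
    linarith
  · obtain ⟨r, hr, rfl⟩ : ∃ r, 0 ≤ r ∧ t = r * (m * s) :=
      ⟨t / (m * s), by positivity, by field_simp⟩
    rw [perspective_mul_mul hp hr hm.le hs]
    have hB := one_add_mul_self_le_rpow_one_add (s := r - 1) (by linarith) hp.le
    rw [add_sub_cancel] at hB
    have := mul_le_mul_of_nonneg_right hB (by positivity : 0 ≤ m ^ p * s)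
    refine le_trans (le_of_eq ?_) this
    rw [rpow_eq_rpow_sub_one_mul hp hm.le]
    ring

/-- Bernoulli's inequality is strict unless `r = 1`, so the plane touches the graph only along its
own ray. -/
theorem eq_mul_of_perspective_eq_tangent {p t s m : ℝ} (hp : 1 < p) (ht : 0 ≤ t) (hs : 0 < s)
    (hm : 0 < m) (h : t ^ p / s ^ (p - 1) = p * m ^ (p - 1) * t - (p - 1) * m ^ p * s) :
    t = m * s := by
  obtain ⟨r, hr, rfl⟩ : ∃ r, 0 ≤ r ∧ t = r * (m * s) :=
    ⟨t / (m * s), by positivity, by field_simp⟩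
  by_contra hne
  have hr1 : r - 1 ≠ 0 := by
    intro h1
    apply hne
    rw [show r = 1 by linarith, one_mul]
  have hB := one_add_mul_self_lt_rpow_one_add (s := r - 1) (by linarith) hr1 hp
  rw [add_sub_cancel] at hB
  have := mul_lt_mul_of_pos_right hB (by positivity : 0 < m ^ p * s)
  rw [perspective_mul_mul hp hr hm.le hs, rpow_eq_rpow_sub_one_mul hp hm.le] at h
  rw [rpow_eq_rpow_sub_one_mul hp hm.le] at this
  linarith

theorem perspective_mul {p m s : ℝ} (hp : 1 < p) (hm : 0 ≤ m) (hs : 0 < s) :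
    (m * s) ^ p / s ^ (p - 1) = m ^ p * s := by
  simpa using perspective_mul_mul hp zero_le_one hm hs

/-- The function `(t, s) ↦ t ^ p / s ^ (p - 1)` is jointly convex. -/
theorem perspective_convex {p t₁ t₂ s₁ s₂ t a b : ℝ} (hp : 1 < p) (ht₁ : 0 ≤ t₁) (ht₂ : 0 ≤ t₂)
    (hs₁ : 0 < s₁) (hs₂ : 0 < s₂) (ha : 0 ≤ a) (hb : 0 ≤ b) (hab : a + b = 1) (ht : 0 ≤ t)
    (hle : t ≤ a * t₁ + b * t₂) :
    t ^ p / (a * s₁ + b * s₂) ^ (p - 1) ≤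
      a * (t₁ ^ p / s₁ ^ (p - 1)) + b * (t₂ ^ p / s₂ ^ (p - 1)) := by
  have hs : 0 < a * s₁ + b * s₂ := by
    rcases ha.eq_or_lt with rfl | ha
    · rw [show b = 1 by linarith]; linarith
    · positivity
  -- The slope `m` is taken at the left-hand point: its tangent plane lies below both endpoint
  -- values, is linear and nondecreasing in `t`, and is exact at that point.
  obtain ⟨m, hm, rfl⟩ : ∃ m, 0 ≤ m ∧ t = m * (a * s₁ + b * s₂) :=
    ⟨t / (a * s₁ + b * s₂), by positivity, by field_simp⟩
  rw [perspective_mul hp hm hs]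
  have h1 := mul_le_mul_of_nonneg_left (tangent_le_perspective hp ht₁ hs₁ hm) ha
  have h2 := mul_le_mul_of_nonneg_left (tangent_le_perspective hp ht₂ hs₂ hm) hb
  have h3 := mul_le_mul_of_nonneg_left hle
    (mul_nonneg (by linarith : 0 ≤ p) (Real.rpow_nonneg hm (p - 1)))
  rw [rpow_eq_rpow_sub_one_mul hp hm] at *
  linarith

/-! ### The derivative of `F` -/

/-- A continuous function on the line that agrees with `dF p c μ` on `[0,∞)`. -/
noncomputable def profile (p c μ s : ℝ) : ℝ := (max (min s μ) (s / (1 + c))) ^ (p - 1)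

/-- Folding the three cases into a max and a min makes continuity and monotonicity evident;
continuity on the whole line lets the fundamental theorem of calculus apply at `0` too. -/
theorem profile_eq_dF {p c μ s : ℝ} (hc : 0 < c) (hs : 0 ≤ s) :
    profile p c μ s = dF p c μ s := by
  unfold profile dF
  have h1 : s / (1 + c) ≤ s := div_le_self hs (by linarith)
  split_ifs with h2 h3
  · rw [min_eq_left h2.le, max_eq_left h1]
  · rw [min_eq_right (not_lt.1 h2), max_eq_left]
    rw [div_le_iff₀ (by linarith)]
    linarith
  · rw [min_eq_right (not_lt.1 h2), max_eq_right, Real.div_rpow hs (by linarith)]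
    rw [le_div_iff₀ (by linarith)]
    linarith

theorem continuous_profile {p c μ : ℝ} (hp : 1 < p) : Continuous (profile p c μ) := by
  unfold profile
  exact Continuous.rpow_const (by fun_prop) fun _ => Or.inr (by linarith)

theorem monotoneOn_profile {p c μ : ℝ} (hp : 1 < p) (hc : 0 < c) :
    MonotoneOn (profile p c μ) (Ici 0) := by
  intro s hs t _ hst
  have hs' : (0 : ℝ) ≤ s := hs
  refine Real.rpow_le_rpow (le_max_of_le_right (by positivity)) ?_ (by linarith)
  gcongr

theorem F_eq_integral_profile {p c μ s : ℝ} (hc : 0 < c) (hs : 0 ≤ s) :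
    F p c μ s = ∫ t in (0 : ℝ)..s, profile p c μ t := by
  refine intervalIntegral.integral_congr fun t ht => ?_
  rw [uIcc_of_le hs] at ht
  exact (profile_eq_dF hc ht.1).symm

theorem hasDerivAt_integral_profile {p c μ : ℝ} (hp : 1 < p) (s : ℝ) :
    HasDerivAt (fun s => ∫ t in (0 : ℝ)..s, profile p c μ t) (profile p c μ s) s :=
  (continuous_profile hp).integral_hasStrictDerivAt 0 s |>.hasDerivAt

theorem F_zero (p c μ : ℝ) : F p c μ 0 = 0 := intervalIntegral.integral_same

theorem hasDerivWithinAt_F {p c μ s : ℝ} (hp : 1 < p) (hc : 0 < c) (hs : 0 ≤ s) :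
    HasDerivWithinAt (F p c μ) (dF p c μ s) (Ici 0) s := by
  rw [← profile_eq_dF hc hs]
  exact (hasDerivAt_integral_profile hp s).hasDerivWithinAt.congr
    (fun t ht => F_eq_integral_profile hc ht) (F_eq_integral_profile hc hs)

theorem contDiffOn_F {p c μ : ℝ} (hp : 1 < p) (hc : 0 < c) :
    ContDiffOn ℝ 1 (F p c μ) (Ici 0) := by
  have h : ContDiff ℝ 1 (fun s => ∫ t in (0 : ℝ)..s, profile p c μ t) := by
    rw [contDiff_one_iff_deriv]
    refine ⟨fun s => (hasDerivAt_integral_profile hp s).differentiableAt, ?_⟩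
    rw [funext fun s => (hasDerivAt_integral_profile (c := c) (μ := μ) hp s).deriv]
    exact continuous_profile hp
  exact h.contDiffOn.congr fun t ht => F_eq_integral_profile hc ht

theorem convexOn_F {p c μ : ℝ} (hp : 1 < p) (hc : 0 < c) :
    ConvexOn ℝ (Ici 0) (F p c μ) := by
  have h : ConvexOn ℝ (Ici 0) (fun s => ∫ t in (0 : ℝ)..s, profile p c μ t) := by
    refine MonotoneOn.convexOn_of_deriv (convex_Ici 0)
      (fun s _ => (hasDerivAt_integral_profile hp s).continuousAt.continuousWithinAt)
      (fun s _ => (hasDerivAt_integral_profile hp s).differentiableAt.differentiableWithinAt) ?_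
    rw [funext fun s => (hasDerivAt_integral_profile (c := c) (μ := μ) hp s).deriv]
    exact (monotoneOn_profile hp hc).mono interior_subset
  exact h.congr fun t ht => (F_eq_integral_profile hc ht).symm

/-! ### Closed forms of `F` -/

theorem intervalIntegrable_profile {p c μ : ℝ} (hp : 1 < p) (a b : ℝ) :
    IntervalIntegrable (profile p c μ) volume a b :=
  (continuous_profile hp).intervalIntegrable a b

theorem F_of_le {p c μ t : ℝ} (hp : 1 < p) (hc : 0 < c) (ht : 0 ≤ t) (htμ : t ≤ μ) :
    F p c μ t = t ^ p / p := by
  rw [F_eq_integral_profile hc ht]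
  have : EqOn (profile p c μ) (fun s => s ^ (p - 1)) (uIcc 0 t) := by
    intro s hs
    rw [uIcc_of_le ht] at hs
    have h1 : s / (1 + c) ≤ s := div_le_self hs.1 (by linarith)
    simp only [profile]
    rw [min_eq_left (hs.2.trans htμ), max_eq_left h1]
  rw [intervalIntegral.integral_congr this, integral_rpow (Or.inl (by linarith)), sub_add_cancel,
    Real.zero_rpow (by linarith), sub_zero]

theorem F_of_mem_Icc {p c μ t : ℝ} (hp : 1 < p) (hc : 0 < c) (hμ : 0 ≤ μ) (hμt : μ ≤ t)
    (ht : t ≤ (1 + c) * μ) : F p c μ t = μ ^ (p - 1) * t - (p - 1) / p * μ ^ p := by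
  have h0 := F_of_le hp hc hμ le_rfl
  rw [F_eq_integral_profile hc hμ] at h0
  rw [F_eq_integral_profile hc (hμ.trans hμt),
    ← intervalIntegral.integral_add_adjacent_intervals (intervalIntegrable_profile hp 0 μ)
      (intervalIntegrable_profile hp μ t), h0]
  have : EqOn (profile p c μ) (fun _ => μ ^ (p - 1)) (uIcc μ t) := by
    intro s hs
    rw [uIcc_of_le hμt] at hs
    simp only [profile]
    rw [min_eq_right hs.1, max_eq_left]
    rw [div_le_iff₀ (by linarith)]
    linarith [hs.2]
  rw [intervalIntegral.integral_congr this, intervalIntegral.integral_const, smul_eq_mul,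
    rpow_eq_rpow_sub_one_mul hp hμ]
  field_simp
  ring

/-- The Lagrange multiplier that corresponds to the threshold `μ`. -/
noncomputable def multiplier (p c μ : ℝ) : ℝ := c * (p - 1) / p * μ ^ p

/-- The constant of integration is the multiplier, so this is the Lagrangian density at `θ = 1`,
just as `F_of_le` is the one at `θ = 0`. -/
theorem F_of_ge {p c μ t : ℝ} (hp : 1 < p) (hc : 0 < c) (hμ : 0 ≤ μ) (ht : (1 + c) * μ ≤ t) :
    F p c μ t = 1 / p * (t ^ p / (1 + c) ^ (p - 1)) + multiplier p c μ := by
  have hc1 : 0 < 1 + c := by linarith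
  have hμc : μ ≤ (1 + c) * μ := by nlinarith
  have h0 := F_of_mem_Icc hp hc hμ hμc le_rfl
  rw [F_eq_integral_profile hc (hμ.trans hμc)] at h0
  rw [F_eq_integral_profile hc (hμ.trans (hμc.trans ht)),
    ← intervalIntegral.integral_add_adjacent_intervals
      (intervalIntegrable_profile hp 0 ((1 + c) * μ))
      (intervalIntegrable_profile hp ((1 + c) * μ) t), h0]
  have : EqOn (profile p c μ) (fun s => s ^ (p - 1) / (1 + c) ^ (p - 1))
      (uIcc ((1 + c) * μ) t) := by
    intro s hs
    rw [uIcc_of_le ht] at hs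
    simp only [profile]
    have hs0 : 0 ≤ s := hμ.trans (hμc.trans hs.1)
    rw [min_eq_right (hμc.trans hs.1), max_eq_right, Real.div_rpow hs0 hc1.le]
    rw [le_div_iff₀ hc1]
    linarith [hs.1]
  rw [intervalIntegral.integral_congr this, intervalIntegral.integral_div,
    integral_rpow (Or.inl (by linarith)), sub_add_cancel, Real.mul_rpow hc1.le hμ,
    rpow_eq_rpow_sub_one_mul hp hc1.le, rpow_eq_rpow_sub_one_mul hp hμ, multiplier,
    rpow_eq_rpow_sub_one_mul hp hμ]
  have : 0 < (1 + c) ^ (p - 1) := Real.rpow_pos_of_pos hc1 _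
  field_simp
  ring

/-! ### `F` as a minimum over the proportion -/

/-- The relation between the norm `t` of the gradient and the proportion `θ` for a given `μ`. -/
def IsOptimalProportion (c μ t θ : ℝ) : Prop :=
  (μ = 0 → 0 < t → θ = 1) ∧
  (0 < μ → θ = if t < μ then 0 else if t ≤ (1 + c) * μ then 1 / c * (t / μ - 1) else 1)

theorem multiplier_nonneg {p c μ : ℝ} (hp : 1 < p) (hc : 0 < c) (hμ : 0 ≤ μ) :
    0 ≤ multiplier p c μ := by
  have : 0 < p - 1 := by linarith
  unfold multiplier
  positivity

/-- In each regime the tangent inequality is used at the slope `m = t / (1 + c θ)` of the expected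
optimal `θ`: `m = t`, `m = μ` or `m = t / (1 + c)`. -/
theorem F_le_and_eq_iff {p c μ t θ : ℝ} (hp : 1 < p) (hc : 0 < c) (hμ : 0 ≤ μ) (ht : 0 ≤ t)
    (hθ : θ ∈ Icc (0 : ℝ) 1) :
    F p c μ t ≤ 1 / p * (t ^ p / (1 + c * θ) ^ (p - 1)) + multiplier p c μ * θ ∧
      (F p c μ t = 1 / p * (t ^ p / (1 + c * θ) ^ (p - 1)) + multiplier p c μ * θ ↔
        IsOptimalProportion c μ t θ) := by
  obtain ⟨hθ0, hθ1⟩ := hθ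
  have hp0 : 0 < p := by linarith
  have hp1 : 0 < p - 1 := by linarith
  have hc1 : 0 < 1 + c := by linarith
  have hs : 0 < 1 + c * θ := by positivity
  have hE := fun m (hm : 0 ≤ m) => mul_le_mul_of_nonneg_left
    (tangent_le_perspective hp ht hs hm) (by positivity : 0 ≤ 1 / p)
  unfold IsOptimalProportion
  rcases lt_or_ge t μ with h1 | h1
  · have hμ0 : 0 < μ := ht.trans_lt h1
    have hlt : t ^ p < μ ^ p := Real.rpow_lt_rpow ht h1 hp0
    have hk : 0 < c * (p - 1) / p * (μ ^ p - t ^ p) := by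
      have : 0 < μ ^ p - t ^ p := by linarith
      positivity
    have hY := hE t ht
    -- The tangent at `m = t` leaves a remainder proportional to `θ`, with a positive factor because
    -- `t < μ`; equality therefore forces `θ = 0`.
    have hY' : t ^ p / p + c * (p - 1) / p * (μ ^ p - t ^ p) * θ ≤
        1 / p * (t ^ p / (1 + c * θ) ^ (p - 1)) + multiplier p c μ * θ := by
      have e : t ^ p / p + c * (p - 1) / p * (μ ^ p - t ^ p) * θ =
          1 / p * (p * t ^ (p - 1) * t - (p - 1) * t ^ p * (1 + c * θ)) +
            multiplier p c μ * θ := by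
        rw [multiplier, mul_assoc p, ← rpow_eq_rpow_sub_one_mul hp ht]
        field_simp
        ring
      rw [e]
      linarith
    rw [F_of_le hp hc ht h1.le]
    refine ⟨by nlinarith [mul_nonneg hk.le hθ0], fun h => ⟨fun h0 => absurd h0 hμ0.ne', ?_⟩, ?_⟩
    · intro _
      rw [if_pos h1]
      by_contra hne
      have := mul_pos hk (lt_of_le_of_ne hθ0 (Ne.symm hne))
      linarith
    · intro h
      have := h.2 hμ0
      rw [if_pos h1] at this
      simp [this]
      ring
  rcases le_or_gt t ((1 + c) * μ) with h2 | h2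
  · rw [F_of_mem_Icc hp hc hμ h1 h2]
    have hY := hE μ hμ
    -- At `m = μ` the terms in `θ` cancel; this dictates the value of `multiplier`.
    have e : 1 / p * (p * μ ^ (p - 1) * t - (p - 1) * μ ^ p * (1 + c * θ)) +
        multiplier p c μ * θ = μ ^ (p - 1) * t - (p - 1) / p * μ ^ p := by
      rw [multiplier]
      field_simp
      ring
    refine ⟨by linarith, ?_⟩
    rcases hμ.eq_or_lt with rfl | hμ0
    -- For `μ = 0` this regime is the point `t = 0`: both sides vanish and every `θ` is optimal.
    · have : t = 0 := by linarith
      simp [this, multiplier, Real.zero_rpow hp0.ne', Real.zero_rpow hp1.ne']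
    rw [if_neg (not_lt.2 h1), if_pos h2, ← e]
    have hiff : (θ = 1 / c * (t / μ - 1)) ↔ t = μ * (1 + c * θ) := by
      constructor
      · rintro rfl
        field_simp
        ring
      · rintro rfl
        field_simp
        ring
    constructor
    · intro h
      refine ⟨fun h0 => absurd h0 hμ0.ne', fun _ => hiff.2 ?_⟩
      refine eq_mul_of_perspective_eq_tangent hp ht hs hμ0 ?_
      have h' := add_right_cancel h
      exact (mul_left_cancel₀ (by positivity) h').symm
    · intro h
      have h := hiff.1 (h.2 hμ0)
      congr 2
      rw [h, perspective_mul hp hμ hs, rpow_eq_rpow_sub_one_mul hp hμ]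
      ring
  · have ht0 : 0 < t := lt_of_le_of_lt (by positivity) h2
    obtain ⟨m, hm, rfl⟩ : ∃ m, μ < m ∧ t = m * (1 + c) :=
      ⟨t / (1 + c), by rw [lt_div_iff₀ hc1]; linarith, by field_simp⟩
    have hm0 : 0 ≤ m := hμ.trans hm.le
    have hlt : μ ^ p < m ^ p := Real.rpow_lt_rpow hμ hm hp0
    have hk : 0 < c * (p - 1) / p * (m ^ p - μ ^ p) := by
      have : 0 < m ^ p - μ ^ p := by linarith
      positivity
    have hY := hE m hm0
    -- Now the remainder is a positive multiple of `1 - θ`, since `m > μ`.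
    have e : 1 / p * (p * m ^ (p - 1) * (m * (1 + c)) - (p - 1) * m ^ p * (1 + c * θ)) +
        multiplier p c μ * θ = 1 / p * (m ^ p * (1 + c)) + multiplier p c μ +
          c * (p - 1) / p * (m ^ p - μ ^ p) * (1 - θ) := by
      rw [multiplier, rpow_eq_rpow_sub_one_mul hp hm0]
      field_simp
      ring
    rw [F_of_ge hp hc hμ h2.le, perspective_mul hp hm0 hc1]
    refine ⟨by nlinarith [mul_nonneg hk.le (sub_nonneg.2 hθ1)], fun h => ?_, ?_⟩
    · have : θ = 1 := by
        by_contra hne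
        have := mul_pos hk (sub_pos.2 (lt_of_le_of_ne hθ1 hne))
        linarith
      exact ⟨fun _ _ => this, fun _ => by rw [if_neg (not_lt.2 h1), if_neg (not_le.2 h2), this]⟩
    · intro h
      have : θ = 1 := by
        rcases hμ.eq_or_lt with h0 | h0
        · exact h.1 h0.symm ht0
        · have := h.2 h0
          rwa [if_neg (not_lt.2 h1), if_neg (not_le.2 h2)] at this
      rw [this, mul_one, mul_one, perspective_mul hp hm0 hc1]

/-- A minimizing proportion. -/
noncomputable def optimalProportion (c μ t : ℝ) : ℝ :=
  if μ = 0 then 1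
  else if t < μ then 0 else if t ≤ (1 + c) * μ then 1 / c * (t / μ - 1) else 1

theorem isOptimalProportion_optimalProportion (c μ t : ℝ) :
    IsOptimalProportion c μ t (optimalProportion c μ t) :=
  ⟨fun h _ => if_pos h, fun h => if_neg h.ne'⟩

theorem optimalProportion_mem {c μ : ℝ} (hc : 0 < c) (hμ : 0 ≤ μ) (t : ℝ) :
    optimalProportion c μ t ∈ Icc (0 : ℝ) 1 := by
  unfold optimalProportion
  split_ifs with h0 h1 h2
  · simp
  · simp
  · have hμ0 : 0 < μ := lt_of_le_of_ne hμ (Ne.symm h0)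
    have h1' : 1 ≤ t / μ := by rw [le_div_iff₀ hμ0]; linarith
    have h2' : t / μ ≤ 1 + c := by rwa [div_le_iff₀ hμ0]
    constructor
    · have : 0 ≤ t / μ - 1 := by linarith
      positivity
    · rw [one_div, inv_mul_le_iff₀ hc]
      linarith
  · simp

theorem measurable_optimalProportion (c μ : ℝ) : Measurable (optimalProportion c μ) := by
  unfold optimalProportion
  refine Measurable.ite (MeasurableSet.const _) measurable_const ?_
  refine Measurable.ite measurableSet_Iio measurable_const ?_
  exact Measurable.ite measurableSet_Iic (by fun_prop) measurable_const

theorem F_nonneg {p c μ t : ℝ} (hc : 0 < c) (ht : 0 ≤ t) : 0 ≤ F p c μ t := by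
  rw [F_eq_integral_profile hc ht]
  refine intervalIntegral.integral_nonneg ht fun s hs => ?_
  have := hs.1
  exact Real.rpow_nonneg (le_max_of_le_right (by positivity)) _

end TwoPhase

namespace TwoPhase

/-! ### Regularity of `F` in `(0,∞)` -/

theorem memLInftyLoc_of_norm_le {g b : ℝ → ℝ} {U : Opens ℝ}
    (hg : AEStronglyMeasurable g (volume.restrict (U : Set ℝ))) (hb : ContinuousOn b U)
    (h : ∀ t ∈ U, ‖g t‖ ≤ b t) : MemLInftyLoc U g := by
  intro K hK hKU
  obtain ⟨C, hC⟩ := hK.exists_bound_of_continuousOn (hb.mono hKU)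
  refine memLp_top_of_bound (hg.mono_measure (Measure.restrict_mono hKU le_rfl)) C ?_
  filter_upwards [ae_restrict_mem hK.measurableSet] with t ht
  exact (h t (hKU ht)).trans ((le_abs_self _).trans (hC t ht))

theorem memLInftyLoc_of_continuousOn {g : ℝ → ℝ} {U : Opens ℝ} (hg : ContinuousOn g U) :
    MemLInftyLoc U g :=
  memLInftyLoc_of_norm_le (hg.aestronglyMeasurable U.isOpen.measurableSet) hg.norm fun _ _ => le_rfl

/-- A continuous function that is differentiable off a countable set, with a locally bounded
derivative, has this derivative as its weak derivative. -/
theorem isWeakDeriv_of_hasDerivAt_off_countable {g g' : ℝ → ℝ} {S : Set ℝ} (hS : S.Countable)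
    (hg : ContinuousOn g (Ioi 0)) (hg' : MemLInftyLoc posHalfLine g')
    (hd : ∀ t, 0 < t → t ∉ S → HasDerivAt g (g' t) t) : IsWeakDeriv posHalfLine g g' := by
  intro φ
  have hφd : ∀ t, HasDerivAt (φ : ℝ → ℝ) (deriv (φ : ℝ → ℝ) t) t := fun t =>
    ((φ.contDiff.differentiable (by simp)).differentiableAt).hasDerivAt
  have hφc : Continuous (deriv (φ : ℝ → ℝ)) := φ.contDiff.continuous_deriv (by simp)
  -- The support stays away from `0`, so all integrals live on `[a, b]` with `a > 0` and the
  -- boundary terms of `g φ` vanish.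
  obtain ⟨a, b, ha, hab, hK⟩ : ∃ a b : ℝ, 0 < a ∧ a ≤ b ∧ tsupport (φ : ℝ → ℝ) ⊆ Ioo a b := by
    have hcpt : IsCompact (tsupport (φ : ℝ → ℝ)) := φ.hasCompactSupport
    rcases (tsupport (φ : ℝ → ℝ)).eq_empty_or_nonempty with h | h
    · exact ⟨1, 1, one_pos, le_rfl, by simp [h]⟩
    · obtain ⟨x, hx, hx'⟩ := hcpt.exists_isLeast h
      obtain ⟨y, hy, hy'⟩ := hcpt.exists_isGreatest h
      have hx0 : 0 < x := φ.tsupport_subset hx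
      have hxy := hx' hy
      exact ⟨x / 2, y + 1, by positivity, by linarith, fun t ht =>
        ⟨by linarith [hx' ht], by linarith [hy' ht]⟩⟩
  have hzero : ∀ t, t ∉ Ioo a b → φ t = 0 ∧ deriv (φ : ℝ → ℝ) t = 0 := fun t ht =>
    ⟨image_eq_zero_of_notMem_tsupport fun h => ht (hK h), by
      by_contra hne
      exact ht (hK (support_deriv_subset hne))⟩
  have hres : ∀ h : ℝ → ℝ, (∀ t, t ∉ Ioo a b → h t = 0) →
      ∫ t in (posHalfLine : Set ℝ), h t = ∫ t in a..b, h t := by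
    intro h hh
    rw [intervalIntegral.integral_of_le hab]
    refine setIntegral_eq_of_subset_of_forall_sdiff_eq_zero measurableSet_Ioi
      (fun t ht => ha.trans ht.1) fun t ht => hh t fun h' => ht.2 ⟨h'.1, h'.2.le⟩
  rw [hres _ fun t ht => by rw [(hzero t ht).2, mul_zero],
    hres _ fun t ht => by rw [(hzero t ht).1, mul_zero]]
  have hsub : Icc a b ⊆ Ioi 0 := fun t ht => ha.trans_le ht.1
  have hi1 : IntervalIntegrable (fun t => g t * deriv (φ : ℝ → ℝ) t) volume a b := by
    refine ContinuousOn.intervalIntegrable ?_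
    rw [uIcc_of_le hab]
    exact (hg.mono hsub).mul hφc.continuousOn
  have hi2 : IntervalIntegrable (fun t => g' t * φ t) volume a b := by
    rw [intervalIntegrable_iff_integrableOn_Icc_of_le hab]
    have h1 : IntegrableOn g' (Icc a b) := (hg' (Icc a b) isCompact_Icc hsub).integrable le_top
    exact h1.mul_continuousOn φ.continuous.continuousOn isCompact_Icc
  have key := integral_eq_of_hasDerivAt_off_countable_of_le (fun t => g t * φ t)
    (fun t => g' t * φ t + g t * deriv (φ : ℝ → ℝ) t) hab hS
    ((hg.mono hsub).mul φ.continuous.continuousOn)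
    (fun t ht => (hd t (ha.trans ht.1.1) ht.2).mul (hφd t)) (hi2.add hi1)
  rw [intervalIntegral.integral_add hi2 hi1, (hzero a (by simp)).1, (hzero b (by simp)).1] at key
  linarith

/-- The second derivative of `F` off the two thresholds. -/
noncomputable def ddF (p c μ s : ℝ) : ℝ :=
  if s < μ then (p - 1) * s ^ (p - 2)
  else if s ≤ (1 + c) * μ then 0
  else (p - 1) * s ^ (p - 2) / (1 + c) ^ (p - 1)

theorem hasDerivAt_dF {p c μ s : ℝ} (hc : 0 < c) (hμ : 0 ≤ μ) (hs : 0 < s)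
    (h1 : s ≠ μ) (h2 : s ≠ (1 + c) * μ) : HasDerivAt (dF p c μ) (ddF p c μ s) s := by
  have hpow : HasDerivAt (fun t : ℝ => t ^ (p - 1)) ((p - 1) * s ^ (p - 2)) s := by
    have := Real.hasDerivAt_rpow_const (x := s) (p := p - 1) (Or.inl hs.ne')
    rwa [show p - 1 - 1 = p - 2 by ring] at this
  have hμc : μ ≤ (1 + c) * μ := by nlinarith
  unfold ddF
  split_ifs with h3 h4
  · refine hpow.congr_of_eventuallyEq ?_
    filter_upwards [Iio_mem_nhds h3] with t ht
    exact if_pos ht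
  · refine (hasDerivAt_const s (μ ^ (p - 1))).congr_of_eventuallyEq ?_
    filter_upwards [Ioi_mem_nhds (lt_of_le_of_ne (not_lt.1 h3) h1.symm),
      Iio_mem_nhds (lt_of_le_of_ne h4 h2)] with t ht ht'
    unfold dF
    rw [if_neg (not_lt.2 (le_of_lt ht)), if_pos (le_of_lt ht')]
  · refine (hpow.div_const _).congr_of_eventuallyEq ?_
    filter_upwards [Ioi_mem_nhds (not_le.1 h4)] with t ht
    unfold dF
    rw [if_neg (not_lt.2 (hμc.trans (le_of_lt ht))), if_neg (not_le.2 ht)]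

/-- The bound is continuous on `(0,∞)` but blows up at `0` when `p < 2`; local boundedness is all
that is needed. -/
theorem norm_ddF_le {p c μ s : ℝ} (hp : 1 < p) (hc : 0 < c) (hs : 0 < s) :
    ‖ddF p c μ s‖ ≤ (p - 1) * s ^ (p - 2) := by
  have hp1 : 0 < p - 1 := by linarith
  have hnn : 0 ≤ (p - 1) * s ^ (p - 2) := by positivity
  unfold ddF
  split_ifs
  · rw [Real.norm_of_nonneg hnn]
  · simpa using hnn
  · rw [Real.norm_of_nonneg (by positivity)]
    exact div_le_self hnn (Real.one_le_rpow (by linarith) hp1.le)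

theorem measurable_ddF (p c μ : ℝ) : Measurable (ddF p c μ) := by
  unfold ddF
  refine Measurable.ite measurableSet_Iio (by fun_prop) ?_
  exact Measurable.ite measurableSet_Iic measurable_const (by fun_prop)

theorem memW2InftyLoc_F {p c μ : ℝ} (hp : 1 < p) (hc : 0 < c) (hμ : 0 ≤ μ) :
    MemW2InftyLoc posHalfLine (F p c μ) := by
  have hF : ContinuousOn (F p c μ) (Ioi 0) :=
    (contDiffOn_F hp hc).continuousOn.mono Ioi_subset_Ici_self
  have hdF : ContinuousOn (dF p c μ) (Ioi 0) :=
    (continuous_profile hp).continuousOn.congr fun t ht => (profile_eq_dF hc (le_of_lt ht)).symm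
  have hdd : MemLInftyLoc posHalfLine (ddF p c μ) := by
    refine memLInftyLoc_of_norm_le (b := fun t => (p - 1) * t ^ (p - 2))
      (measurable_ddF p c μ).aestronglyMeasurable ?_ fun t ht => norm_ddF_le hp hc ht
    exact continuousOn_const.mul
      (continuousOn_id.rpow_const fun t ht => Or.inl (ne_of_gt ht))
  have hd := memLInftyLoc_of_continuousOn (U := posHalfLine) hdF
  refine ⟨dF p c μ, ddF p c μ, memLInftyLoc_of_continuousOn hF, hd, hdd, ?_, ?_⟩
  · exact isWeakDeriv_of_hasDerivAt_off_countable countable_empty hF hd fun t ht _ =>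
      (hasDerivWithinAt_F hp hc ht.le).hasDerivAt (Ici_mem_nhds ht)
  · refine isWeakDeriv_of_hasDerivAt_off_countable (S := {μ, (1 + c) * μ})
      ((countable_singleton _).insert _) hdF hdd fun t ht hS => ?_
    simp only [mem_insert_iff, mem_singleton_iff, not_or] at hS
    exact hasDerivAt_dF hc hμ ht hS.1 hS.2

end TwoPhase

/-- A Lagrange multiplier exists for a convex minimization problem with one convex inequality
constraint that satisfies Slater's condition. -/
theorem ConvexOn.exists_lagrange_multiplier {V : Type*} [AddCommMonoid V] [SMul ℝ V] {S : Set V}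
    {E k : V → ℝ} (hE : ConvexOn ℝ S E) (hk : ConvexOn ℝ S k) {κ : ℝ} {x₀ x : V} (hx₀ : x₀ ∈ S)
    (hkx₀ : k x₀ < κ) (hx : x ∈ S) (hkx : k x ≤ κ) (hmin : ∀ y ∈ S, k y ≤ κ → E x ≤ E y) :
    ∃ l : ℝ, 0 ≤ l ∧ l * (k x - κ) = 0 ∧ ∀ y ∈ S, E x + l * k x ≤ E y + l * k y := by
  -- A multiplier must dominate these slopes, given by the infeasible points, and `0`; the least
  -- candidate is `sSup R`.
  set R : Set ℝ := insert 0 ((fun y => (E x - E y) / (k y - κ)) '' {y ∈ S | κ < k y}) with hR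
  -- On the segment from an infeasible `y` to a strictly feasible `z`, take the weights at which the
  -- interpolated constraint equals `κ`. By convexity that point is feasible, and minimality of `x`
  -- there compares the two slopes.
  have hbound : ∀ z ∈ S, k z < κ → ∀ r ∈ R, r ≤ (E z - E x) / (κ - k z) := by
    intro z hz hkz r hr
    have hz0 : 0 < κ - k z := by linarith
    rcases hr with rfl | ⟨y, ⟨hy, hky⟩, rfl⟩
    · have := hmin z hz hkz.le
      exact div_nonneg (by linarith) hz0.le
    · have hy0 : 0 < k y - κ := by linarith
      have hd : 0 < k y - k z := by linarith
      have ha : 0 ≤ (κ - k z) / (k y - k z) := by positivity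
      have hb : 0 ≤ (k y - κ) / (k y - k z) := by positivity
      have hab : (κ - k z) / (k y - k z) + (k y - κ) / (k y - k z) = 1 := by
        field_simp
        ring
      have hkw := hk.2 hy hz ha hb hab
      have hEw := hE.2 hy hz ha hb hab
      have hκ : (κ - k z) / (k y - k z) * k y + (k y - κ) / (k y - k z) * k z = κ := by
        field_simp
        ring
      simp only [smul_eq_mul] at hkw hEw
      have h := (hmin _ (hE.1 hy hz ha hb hab) (hkw.trans hκ.le)).trans hEw
      have e : (κ - k z) / (k y - k z) * E y + (k y - κ) / (k y - k z) * E z =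
          ((κ - k z) * E y + (k y - κ) * E z) / (k y - k z) := by ring
      rw [e, le_div_iff₀ hd] at h
      rw [div_le_div_iff₀ hy0 hz0]
      linarith
  have hbdd : BddAbove R := ⟨_, fun r hr => hbound x₀ hx₀ hkx₀ r hr⟩
  have hl0 : 0 ≤ sSup R := le_csSup hbdd (mem_insert _ _)
  have hmain : ∀ y ∈ S, E x ≤ E y + sSup R * (k y - κ) := by
    intro y hy
    rcases lt_trichotomy (k y) κ with h | h | h
    · have := csSup_le ⟨0, mem_insert _ _⟩ (hbound y hy h)
      rw [le_div_iff₀ (by linarith)] at this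
      linarith
    · rw [h, sub_self, mul_zero, add_zero]
      exact hmin y hy h.le
    · have := le_csSup hbdd (mem_insert_of_mem _ (mem_image_of_mem _ ⟨hy, h⟩))
      rw [div_le_iff₀ (by linarith)] at this
      linarith
  have hslack : sSup R * (k x - κ) = 0 :=
    le_antisymm (mul_nonpos_of_nonneg_of_nonpos hl0 (by linarith)) (by linarith [hmain x hx])
  refine ⟨sSup R, hl0, hslack, fun y hy => ?_⟩
  linarith [hmain y hy]

namespace TwoPhase

/-- Every multiplier `l ≥ 0` comes from a threshold, so parametrizing by `μ` loses nothing. -/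
theorem exists_multiplier_eq {p c l : ℝ} (hp : 1 < p) (hc : 0 < c) (hl : 0 ≤ l) :
    ∃ μ, 0 ≤ μ ∧ multiplier p c μ = l := by
  have hp1 : 0 < p - 1 := by linarith
  have hp0 : 0 < p := by linarith
  refine ⟨(l / (c * (p - 1) / p)) ^ p⁻¹, by positivity, ?_⟩
  rw [multiplier, Real.rpow_inv_rpow (by positivity) hp0.ne']
  field_simp

variable {N : ℕ} {p : ℝ} [hp : Fact (1 < p)] {Ω : Opens (Space N)} {c μ κ : ℝ}

theorem isFiniteMeasure_lebesgueOn (hΩ : Bornology.IsBounded (Ω : Set (Space N))) :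
    IsFiniteMeasure (lebesgueOn Ω) :=
  ⟨by simpa using hΩ.measure_lt_top⟩

/-! ### Integrability -/

theorem integrable_norm_rpow_grad (u : W10 p Ω) :
    Integrable (fun x => ‖grad u x‖ ^ p) (lebesgueOn Ω) := by
  have hp0 : 0 < p := by linarith [hp.out]
  have h := (Lp.memLp (grad u)).integrable_norm_rpow (ENNReal.ofReal_pos.2 hp0).ne'
    ENNReal.ofReal_ne_top
  rwa [ENNReal.toReal_ofReal hp0.le] at h

theorem aemeasurable_norm_grad (u : W10 p Ω) :
    AEMeasurable (fun x => ‖grad u x‖) (lebesgueOn Ω) :=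
  (Lp.aestronglyMeasurable (grad u)).norm.aemeasurable

theorem integrable_proportion [IsFiniteMeasure (lebesgueOn Ω)] (θ : Lp ℝ ∞ (lebesgueOn Ω)) :
    Integrable θ (lebesgueOn Ω) :=
  (Lp.memLp θ).integrable le_top

theorem integrable_density (hc : 0 < c) (u : W10 p Ω) {θ : Lp ℝ ∞ (lebesgueOn Ω)}
    (hθ : θ ∈ proportions Ω) :
    Integrable (fun x => ‖grad u x‖ ^ p / (1 + c * θ x) ^ (p - 1)) (lebesgueOn Ω) := by
  refine (integrable_norm_rpow_grad u).mono' ?_ ?_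
  · refine AEMeasurable.aestronglyMeasurable ?_
    exact ((aemeasurable_norm_grad u).pow_const p).div
      ((((Lp.aestronglyMeasurable θ).aemeasurable.const_mul c).const_add 1).pow_const _)
  · filter_upwards [hθ] with x hx
    have h1 : 1 ≤ 1 + c * θ x := by
      have := mul_nonneg hc.le hx.1
      linarith
    have h2 : 1 ≤ (1 + c * θ x) ^ (p - 1) := Real.one_le_rpow h1 (by linarith [hp.out])
    rw [Real.norm_of_nonneg (by positivity)]
    exact div_le_self (by positivity) h2

theorem integrable_F_norm_grad (hc : 0 < c) (hμ : 0 ≤ μ) (u : W10 p Ω) :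
    Integrable (fun x => F p c μ ‖grad u x‖) (lebesgueOn Ω) := by
  refine ((integrable_norm_rpow_grad u).const_mul (1 / p)).mono' ?_ ?_
  · have hcont : Continuous (fun s => ∫ t in (0 : ℝ)..s, profile p c μ t) :=
      continuous_iff_continuousAt.2 fun s => (hasDerivAt_integral_profile hp.out s).continuousAt
    refine (hcont.measurable.comp_aemeasurable
      (aemeasurable_norm_grad u)).aestronglyMeasurable.congr ?_
    exact Filter.Eventually.of_forall fun x => (F_eq_integral_profile hc (norm_nonneg _)).symm
  · refine Filter.Eventually.of_forall fun x => ?_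
    rw [Real.norm_of_nonneg (F_nonneg hc (norm_nonneg _))]
    -- Taking `θ = 0` bounds `F t` by `t ^ p / p`.
    simpa using (F_le_and_eq_iff hp.out hc hμ (norm_nonneg (grad u x))
      (left_mem_Icc.2 zero_le_one)).1

/-! ### The Lagrangian -/

/-- Minimizing the Lagrangian in the proportion gives the integral of `F`. -/
theorem integral_F_le_and_eq_iff [IsFiniteMeasure (lebesgueOn Ω)] (hc : 0 < c) (hμ : 0 ≤ μ)
    (u : W10 p Ω) {θ : Lp ℝ ∞ (lebesgueOn Ω)} (hθ : θ ∈ proportions Ω) :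
    ∫ x in (Ω : Set (Space N)), F p c μ ‖grad u x‖ ≤
        1 / p * (∫ x in (Ω : Set (Space N)), ‖grad u x‖ ^ p / (1 + c * θ x) ^ (p - 1)) +
          multiplier p c μ * ∫ x in (Ω : Set (Space N)), θ x ∧
      (∫ x in (Ω : Set (Space N)), F p c μ ‖grad u x‖ =
        1 / p * (∫ x in (Ω : Set (Space N)), ‖grad u x‖ ^ p / (1 + c * θ x) ^ (p - 1)) +
          multiplier p c μ * ∫ x in (Ω : Set (Space N)), θ x ↔
        ∀ᵐ x ∂(lebesgueOn Ω), IsOptimalProportion c μ ‖grad u x‖ (θ x)) := by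
  have hF := integrable_F_norm_grad hc hμ u
  have h1 := (integrable_density hc u hθ).const_mul (1 / p)
  have h2 := (integrable_proportion θ).const_mul (multiplier p c μ)
  have hle : ∀ᵐ x ∂(lebesgueOn Ω), F p c μ ‖grad u x‖ ≤
      1 / p * (‖grad u x‖ ^ p / (1 + c * θ x) ^ (p - 1)) + multiplier p c μ * θ x := by
    filter_upwards [hθ] with x hx
    exact (F_le_and_eq_iff hp.out hc hμ (norm_nonneg _) hx).1
  rw [← integral_const_mul, ← integral_const_mul, ← integral_add h1 h2]
  refine ⟨integral_mono_ae hF (h1.add h2) hle, ?_⟩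
  refine (integral_eq_iff_of_ae_le hF (h1.add h2) hle).trans (Filter.eventually_congr ?_)
  filter_upwards [hθ] with x hx
  exact (F_le_and_eq_iff hp.out hc hμ (norm_nonneg _) hx).2

/-- A measurable selection attains the pointwise minimum. No volume bound is required of it, since
the Lagrangian is minimized over all proportions. -/
theorem exists_optimalProportion [IsFiniteMeasure (lebesgueOn Ω)] (hc : 0 < c) (hμ : 0 ≤ μ)
    (u : W10 p Ω) : ∃ θ ∈ proportions Ω,
      ∀ᵐ x ∂(lebesgueOn Ω), IsOptimalProportion c μ ‖grad u x‖ (θ x) := by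
  have hmem : MemLp (fun x => optimalProportion c μ ‖grad u x‖) ∞ (lebesgueOn Ω) := by
    refine memLp_top_of_bound ((measurable_optimalProportion c μ).comp_aemeasurable
      (aemeasurable_norm_grad u)).aestronglyMeasurable 1 (Filter.Eventually.of_forall fun x => ?_)
    have h := optimalProportion_mem hc hμ ‖grad u x‖
    rw [Real.norm_of_nonneg h.1]
    exact h.2
  refine ⟨hmem.toLp _, ?_, ?_⟩
  · filter_upwards [hmem.coeFn_toLp] with x hx
    rw [hx]
    exact optimalProportion_mem hc hμ _
  · filter_upwards [hmem.coeFn_toLp] with x hx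
    rw [hx]
    exact isOptimalProportion_optimalProportion c μ _

/-- Both cases of the relation become pointwise optimality, feasibility and complementary slackness.
-/
theorem proportionRelation_iff {u : W10 p Ω} {θ : Lp ℝ ∞ (lebesgueOn Ω)} (hμ : 0 ≤ μ) :
    ProportionRelation c κ μ u θ ↔
      (∀ᵐ x ∂(lebesgueOn Ω), IsOptimalProportion c μ ‖grad u x‖ (θ x)) ∧
        ∫ x in (Ω : Set (Space N)), θ x ≤ κ ∧
        (0 < μ → ∫ x in (Ω : Set (Space N)), θ x = κ) := by
  rcases hμ.eq_or_lt with rfl | hμ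
  · simp [ProportionRelation, IsOptimalProportion]
  · simp only [ProportionRelation, IsOptimalProportion, hμ.ne', hμ, false_imp_iff, true_and,
      true_imp_iff]
    exact and_congr_right fun _ => ⟨fun h => ⟨h.le, h⟩, fun h => h.2⟩

/-! ### Convexity of the relaxed problem -/

theorem coeFn_combo {E : Type*} [NormedAddCommGroup E] [NormedSpace ℝ E] {q : ℝ≥0∞}
    {m : Measure (Space N)} (a b : ℝ) (g h : Lp E q m) :
    ∀ᵐ x ∂m, (a • g + b • h : Lp E q m) x = a • g x + b • h x := by
  filter_upwards [Lp.coeFn_add (a • g) (b • h), Lp.coeFn_smul a g, Lp.coeFn_smul b h]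
    with x h1 h2 h3
  rw [h1, Pi.add_apply, h2, h3, Pi.smul_apply, Pi.smul_apply]

theorem convex_proportions : Convex ℝ (proportions Ω) := by
  intro θ hθ η hη a b ha hb hab
  filter_upwards [hθ, hη, coeFn_combo a b θ η] with x h1 h2 h3
  rw [h3]
  exact convex_Icc 0 1 h1 h2 ha hb hab

theorem convexOn_integral_proportion [IsFiniteMeasure (lebesgueOn Ω)] :
    ConvexOn ℝ (univ ×ˢ proportions Ω : Set (W10 p Ω × Lp ℝ ∞ (lebesgueOn Ω)))
      (fun w => ∫ x in (Ω : Set (Space N)), w.2 x) := by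
  refine ⟨convex_univ.prod convex_proportions, fun v _ w _ a b _ _ _ => le_of_eq ?_⟩
  have h := integral_congr_ae (coeFn_combo a b v.2 w.2)
  refine h.trans ((integral_add ((integrable_proportion v.2).smul a)
    ((integrable_proportion w.2).smul b)).trans ?_)
  simp only [Pi.smul_apply, integral_smul]

/-- The density is the jointly convex perspective function, nondecreasing in `t`, evaluated at the
convex `‖∇u‖` and the affine `1 + c θ`. -/
theorem convexOn_relaxedEnergy (hc : 0 < c) (f : WDual p Ω) :
    ConvexOn ℝ (univ ×ˢ proportions Ω : Set (W10 p Ω × Lp ℝ ∞ (lebesgueOn Ω)))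
      (fun w => relaxedEnergy c f w.1 w.2) := by
  have hp0 : 0 < p := by linarith [hp.out]
  refine ⟨convex_univ.prod convex_proportions, ?_⟩
  rintro ⟨u, θ⟩ ⟨_, hθ⟩ ⟨v, η⟩ ⟨_, hη⟩ a b ha hb hab
  have hθη : a • θ + b • η ∈ proportions Ω := convex_proportions hθ hη ha hb hab
  simp only [Prod.smul_mk, Prod.mk_add_mk, relaxedEnergy, map_add, map_smul, smul_eq_mul]
  have h1 := (integrable_density hc u hθ).const_mul a
  have h2 := (integrable_density hc v hη).const_mul b
  have hgrad : ∀ᵐ x ∂(lebesgueOn Ω), grad (a • u + b • v) x = a • grad u x + b • grad v x :=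
    coeFn_combo a b (grad u) (grad v)
  have key : ∫ x in (Ω : Set (Space N)),
      ‖grad (a • u + b • v) x‖ ^ p / (1 + c * (a • θ + b • η : Lp ℝ ∞ (lebesgueOn Ω)) x) ^ (p - 1) ≤
      a * (∫ x in (Ω : Set (Space N)), ‖grad u x‖ ^ p / (1 + c * θ x) ^ (p - 1)) +
      b * (∫ x in (Ω : Set (Space N)), ‖grad v x‖ ^ p / (1 + c * η x) ^ (p - 1)) := by
    rw [← integral_const_mul, ← integral_const_mul, ← integral_add h1 h2]
    refine integral_mono_ae (integrable_density hc _ hθη) (h1.add h2) ?_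
    filter_upwards [hgrad, coeFn_combo a b θ η, hθ, hη] with x hx1 hx2 hx3 hx4
    rw [hx1, hx2]
    have e : 1 + c * (a • θ x + b • η x) = a * (1 + c * θ x) + b * (1 + c * η x) := by
      rw [smul_eq_mul, smul_eq_mul]
      linear_combination -hab
    rw [e]
    refine perspective_convex hp.out (norm_nonneg _) (norm_nonneg _) ?_ ?_ ha hb hab
      (norm_nonneg _) ?_
    · have := mul_nonneg hc.le hx3.1
      linarith
    · have := mul_nonneg hc.le hx4.1
      linarith
    · refine (norm_add_le _ _).trans (le_of_eq ?_)
      rw [norm_smul, norm_smul, Real.norm_of_nonneg ha, Real.norm_of_nonneg hb]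
  have := mul_le_mul_of_nonneg_left key (by positivity : 0 ≤ 1 / p)
  linarith

/-! ### The optimality conditions -/

/-- Weak duality: the `F`-energy bounds the Lagrangian below for every competitor, with equality at
`(u, θ)`. -/
theorem isRelaxedSolution_of_isFMinimizer [IsFiniteMeasure (lebesgueOn Ω)] (hc : 0 < c)
    (hμ : 0 ≤ μ) {f : WDual p Ω} {u : W10 p Ω} {θ : Lp ℝ ∞ (lebesgueOn Ω)}
    (hθ : θ ∈ proportions Ω) (hu : IsFMinimizer c μ f u) (hr : ProportionRelation c κ μ u θ) :
    IsRelaxedSolution c κ f u θ := by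
  obtain ⟨hopt, hle, heq⟩ := (proportionRelation_iff hμ).1 hr
  refine ⟨⟨hθ, hle⟩, fun w hw => ?_⟩
  have h1 := (integral_F_le_and_eq_iff hc hμ u hθ).2.2 hopt
  have h2 := (integral_F_le_and_eq_iff hc hμ w.1 hw.1).1
  have h3 := hu w.1
  have h4 : multiplier p c μ * (∫ x in (Ω : Set (Space N)), w.2 x) ≤
      multiplier p c μ * ∫ x in (Ω : Set (Space N)), θ x := by
    -- If `μ = 0` the multiplier is zero; otherwise `θ` uses the full volume `κ`.
    rcases hμ.eq_or_lt with rfl | hμ0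
    · have : p ≠ 0 := by linarith [hp.out]
      simp [multiplier, Real.zero_rpow this]
    · rw [heq hμ0]
      exact mul_le_mul_of_nonneg_left hw.2 (multiplier_nonneg hp.out hc hμ)
  simp only [relaxedEnergy]
  linarith

theorem exists_multiplier_of_isRelaxedSolution [IsFiniteMeasure (lebesgueOn Ω)] (hc : 0 < c)
    (hκ : 0 < κ) {f : WDual p Ω} {u : W10 p Ω} {θ : Lp ℝ ∞ (lebesgueOn Ω)}
    (h : IsRelaxedSolution c κ f u θ) :
    ∃ l : ℝ, 0 ≤ l ∧ l * ((∫ x in (Ω : Set (Space N)), θ x) - κ) = 0 ∧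
      ∀ (v : W10 p Ω), ∀ η ∈ proportions Ω,
        relaxedEnergy c f u θ + l * (∫ x in (Ω : Set (Space N)), θ x) ≤
          relaxedEnergy c f v η + l * ∫ x in (Ω : Set (Space N)), η x := by
  obtain ⟨⟨hθ, hle⟩, hmin⟩ := h
  have hzero : (0 : Lp ℝ ∞ (lebesgueOn Ω)) ∈ proportions Ω := by
    filter_upwards [Lp.coeFn_zero ℝ ∞ (lebesgueOn Ω)] with x hx
    rw [hx]
    exact left_mem_Icc.2 zero_le_one
  have hzero' : ∫ x in (Ω : Set (Space N)), (0 : Lp ℝ ∞ (lebesgueOn Ω)) x < κ := by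
    rw [integral_congr_ae (Lp.coeFn_zero ℝ ∞ (lebesgueOn Ω))]
    simpa using hκ
  have hx : ((u, θ) : W10 p Ω × Lp ℝ ∞ (lebesgueOn Ω)) ∈ univ ×ˢ proportions Ω :=
    mk_mem_prod (mem_univ u) hθ
  have hx₀ : ((u, 0) : W10 p Ω × Lp ℝ ∞ (lebesgueOn Ω)) ∈ univ ×ˢ proportions Ω :=
    mk_mem_prod (mem_univ u) hzero
  obtain ⟨l, hl, hslack, hL⟩ := ConvexOn.exists_lagrange_multiplier
    (convexOn_relaxedEnergy hc f) convexOn_integral_proportion hx₀ hzero' hx hle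
    fun w hw hw' => hmin w ⟨hw.2, hw'⟩
  exact ⟨l, hl, hslack, fun v η hη => hL (v, η) (mk_mem_prod (mem_univ v) hη)⟩

/-- Minimizing the Lagrangian over the proportion bounds its value at `(u, θ)` by every `F`-energy.
For `u` itself the opposite bound also holds; the resulting equality gives minimality of `u` and
pointwise optimality of `θ`. -/
theorem exists_isFMinimizer_of_isRelaxedSolution [IsFiniteMeasure (lebesgueOn Ω)] (hc : 0 < c)
    (hκ : 0 < κ) {f : WDual p Ω} {u : W10 p Ω} {θ : Lp ℝ ∞ (lebesgueOn Ω)}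
    (h : IsRelaxedSolution c κ f u θ) :
    ∃ μ : ℝ, 0 ≤ μ ∧ IsFMinimizer c μ f u ∧ ProportionRelation c κ μ u θ := by
  obtain ⟨hθ, hle⟩ := h.1
  obtain ⟨l, hl, hslack, hL⟩ := exists_multiplier_of_isRelaxedSolution hc hκ h
  obtain ⟨μ, hμ, rfl⟩ := exists_multiplier_eq hp.out hc hl
  have hbelow : ∀ v : W10 p Ω, relaxedEnergy c f u θ +
      multiplier p c μ * (∫ x in (Ω : Set (Space N)), θ x) ≤
        (∫ x in (Ω : Set (Space N)), F p c μ ‖grad v x‖) - f v := by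
    intro v
    obtain ⟨η, hη, hopt⟩ := exists_optimalProportion hc hμ v
    have h1 := (integral_F_le_and_eq_iff hc hμ v hη).2.2 hopt
    have h2 := hL v η hη
    simp only [relaxedEnergy] at h2 ⊢
    linarith
  obtain ⟨h1, h2⟩ := integral_F_le_and_eq_iff hc hμ u hθ
  have h3 := hbelow u
  simp only [relaxedEnergy] at h3 hbelow
  refine ⟨μ, hμ, fun v => ?_, (proportionRelation_iff hμ).2
    ⟨h2.1 (le_antisymm h1 (by linarith)), hle, fun hμ0 => ?_⟩⟩
  · linarith [hbelow v]
  · have hpos : 0 < multiplier p c μ := by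
      have h0 : 0 < p := by linarith [hp.out]
      have h1 : 0 < p - 1 := by linarith [hp.out]
      unfold multiplier
      positivity
    have := (mul_eq_zero.1 hslack).resolve_left hpos.ne'
    exact sub_eq_zero.1 this

end TwoPhase

theorem mainTheorem3 (N : ℕ) (hN : 1 ≤ N) (p : ℝ) [hp : Fact (1 < p)]
    (Ω : TopologicalSpace.Opens (TwoPhase.Space N))
    (hΩ : Bornology.IsBounded (Ω : Set (TwoPhase.Space N)))
    (α β κ : ℝ) (hα : 0 < α) (hαβ : α < β) (hκ : 0 < κ)
    (hκΩ : ENNReal.ofReal κ < MeasureTheory.volume (Ω : Set (TwoPhase.Space N)))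
    (f : TwoPhase.WDual p Ω) (c : ℝ) (hc : c = TwoPhase.contrast p α β) :
    (∀ μ : ℝ, 0 ≤ μ →
      TwoPhase.F p c μ 0 = 0 ∧
      (∀ s ∈ Set.Ici (0 : ℝ),
        HasDerivWithinAt (TwoPhase.F p c μ) (TwoPhase.dF p c μ s) (Set.Ici 0) s) ∧
      ContDiffOn ℝ 1 (TwoPhase.F p c μ) (Set.Ici 0) ∧
      TwoPhase.MemW2InftyLoc TwoPhase.posHalfLine (TwoPhase.F p c μ) ∧
      ConvexOn ℝ (Set.Ici 0) (TwoPhase.F p c μ)) ∧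
    ∀ (u : TwoPhase.W10 p Ω) (θ : MeasureTheory.Lp ℝ ⊤ (TwoPhase.lebesgueOn Ω)),
      θ ∈ TwoPhase.proportions Ω →
        (TwoPhase.IsRelaxedSolution c κ f u θ ↔
          ∃ μ : ℝ, 0 ≤ μ ∧ TwoPhase.IsFMinimizer c μ f u ∧
            TwoPhase.ProportionRelation c κ μ u θ) := by
  have hc0 : 0 < c := hc ▸ TwoPhase.contrast_pos hp.out hα hαβ
  have := TwoPhase.isFiniteMeasure_lebesgueOn hΩ
  refine ⟨fun μ hμ => ⟨TwoPhase.F_zero p c μ,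
    fun s hs => TwoPhase.hasDerivWithinAt_F hp.out hc0 hs, TwoPhase.contDiffOn_F hp.out hc0,
    TwoPhase.memW2InftyLoc_F hp.out hc0 hμ, TwoPhase.convexOn_F hp.out hc0⟩,
    fun u θ hθ => ⟨TwoPhase.exists_isFMinimizer_of_isRelaxedSolution hc0 hκ, ?_⟩⟩
  rintro ⟨μ, hμ, hu, hr⟩
  exact TwoPhase.isRelaxedSolution_of_isFMinimizer hc0 hμ hθ hu hr
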